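/- Let $\tau\in\mathbb C$ with $\operatorname{Im}\tau>0$ and $r\in\mathbb C\setminus\{0\}$, and put $p=e^{-2\pi i/\tau}$, $x=e^{-\pi i/(r\tau)}=-q$. Let $$\vartheta_1(u|\tau)=2\tilde p^{1/8}(\tilde p;\tilde p)_\infty\sin\pi u\prod_{l\ge1}(1-2\tilde p^l\cos2\pi u+\tilde p^{2l}),\qquad \tilde p=e^{2\pi i\tau},\quad \tilde p^{1/8}=e^{\pi i\tau/4},$$ $[u]=C\,\vartheta_1(u/r\,|\,\tau)$ with $C=e^{\pi i/(4\tau)}e^{-\pi i/4}\tau^{1/2}$ (principal branch), $[u]_n=\prod_{j=0}^{n-1}[u+j]$, $[\alpha\pm rz]_n=[\alpha+rz]_n[\alpha-rz]_n$. For $k\ge 0$ and $0\le n\le k$ let $$e_n^k(z;\alpha,\beta)=[\alpha\pm rz]_n[\beta\pm rz]_{k-n}.$$ Call $(\gamma,\delta)$ generic at level $k$ if $(\gamma-\delta+j)/r\notin\mathbb Z+\tau\mathbb Z$ for $1-k\le j\le k-1$ and $(\gamma+\delta+j)/r\notin\mathbb Z+\tau\mathbb Z$ for $0\le j\le k-1$.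 For all $\alpha,\beta\in\mathbb C$ and all $(\gamma,\delta)$ generic at level $k$, the functions $e_m^k(\,\cdot\,;\gamma,\delta)$ ($0\le m\le k$) are linearly independent, and the elliptic $6j$-symbols $R_n^m(\alpha,\beta,\gamma,\delta;k;q,p)$ are well defined as the coefficients in $$e_n^k(z;\alpha,\beta)=\sum_{m=0}^kR_n^m(\alpha,\beta,\gamma,\delta;k;q,p)\,e_m^k(z;\gamma,\delta)\qquad(z\in\mathbb C,\ 0\le n\le k).$$ **Proposition (fusion / combinatorial formula).** Let $\alpha,\beta\in\mathbb C$, let $(\gamma,\delta)$ be generic at level $k$, let $0\le n,m\le k$, and let $n_1,\dots,n_k\in\{0,1\}$ be any sequence with $\sum_j n_j=n$. Then $$R_n^m(\alpha,\beta,\gamma,\delta;k;q,p)=\sum_{\substack{m_1,\dots,m_k\in\{0,1\}\\ m_1+\cdots+m_k=m}}\ \prod_{j=1}^kR_{n_j}^{m_j}(\alpha_{j-1},\beta_{j-1},\gamma_{j-1},\delta_{j-1};1;q,p),$$ where, for $1\le j\le k$, $$\alpha_{j-1}=\alpha+\sum_{i<j}n_i,\quad \beta_{j-1}=\beta+\sum_{i<j}(1-n_i),\quad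 \gamma_{j-1}=\gamma+\sum_{i<j}m_i,\quad \delta_{j-1}=\delta+\sum_{i<j}(1-m_i),$$ and every $(\gamma_{j-1},\delta_{j-1})$ is generic at level $1$. In particular, let $u,a,c\in\mathbb C$ and $$\alpha=\tfrac{-u+a-k+1}2,\quad \beta=\tfrac{-u-a-k+1}2,\quad \gamma=\tfrac{-u+c-k+1}2,\quad \delta=\tfrac{-u-c-k+1}2,$$ with $(\gamma,\delta)$ generic at level $k$, and let the heights be given by $a_0=a$, $c_0=c$, $a_{j-1}-a_j=1-2n_j$, $c_{j-1}-c_j=1-2m_j$. Then the formula holds with the parameters of the $j$-th factor equal to $$\alpha_{j-1}=\tfrac{-u+a_{j-1}-k+j}2,\quad \beta_{j-1}=\tfrac{-u-a_{j-1}-k+j}2,\quad \gamma_{j-1}=\tfrac{-u+c_{j-1}-k+j}2,\quad \delta_{j-1}=\tfrac{-u-c_{j-1}-k+j}2 .$$ -/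

import Mathlib

namespace Elliptic6j

/-- The theta function
`ϑ₁(u|τ) = 2 t^{1/8} (t;t)_∞ sin(πu) ∏_{n ≥ 1} (1 - 2 tⁿ cos(2πu) + t²ⁿ)` with `t = e^{2πiτ}`. -/
noncomputable def theta₁ (τ u : ℂ) : ℂ :=
  2 * Complex.exp (2 * Real.pi * Complex.I * τ / 8)
    * (∏' n : ℕ, (1 - Complex.exp (2 * Real.pi * Complex.I * τ) ^ (n + 1)))
    * Complex.sin (Real.pi * u)
    * ∏' n : ℕ, (1 - 2 * Complex.exp (2 * Real.pi * Complex.I * τ) ^ (n + 1)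
          * Complex.cos (2 * Real.pi * u)
        + Complex.exp (2 * Real.pi * Complex.I * τ) ^ (2 * (n + 1)))

/-- The constant `C = x^{-r/4} e^{-πi/4} τ^{1/2}`, where `x = e^{-πi/(rτ)}`, so that
`x^{-r/4} = e^{πi/(4τ)}`. -/
noncomputable def bracketConst (τ : ℂ) : ℂ :=
  Complex.exp (Real.pi * Complex.I / (4 * τ)) * Complex.exp (-(Real.pi * Complex.I / 4))
    * τ ^ (1 / 2 : ℂ)

/-- The symbol `[u] = C ϑ₁(u/r | τ)`. -/
noncomputable def bracket (τ r u : ℂ) : ℂ :=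
  bracketConst τ * theta₁ τ (u / r)

/-- The elliptic shifted factorial `[u]_n = ∏_{j=0}^{n-1} [u + j]`. -/
noncomputable def shiftedFactorial (τ r u : ℂ) (n : ℕ) : ℂ :=
  ∏ j ∈ Finset.range n, bracket τ r (u + j)

/-- `[α ± rz]_n = [α + rz]_n [α - rz]_n`. -/
noncomputable def shiftedFactorialPM (τ r α z : ℂ) (n : ℕ) : ℂ :=
  shiftedFactorial τ r (α + r * z) n * shiftedFactorial τ r (α - r * z) n

/-- The function `z ↦ e_n^k(z; α, β) = [α ± rz]_n [β ± rz]_{k-n}`, for `0 ≤ n ≤ k`. -/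
noncomputable def naturalVec (τ r : ℂ) (k : ℕ) (n : Fin (k + 1)) (α β : ℂ) : ℂ → ℂ :=
  fun z => shiftedFactorialPM τ r α z n * shiftedFactorialPM τ r β z (k - n)

/-- Genericity of `(γ, δ)` at level `k`, under which the functions `e_m^k(·; γ, δ)`, `0 ≤ m ≤ k`,
are a basis (the natural basis): `(γ - δ + j)/r ∉ ℤ + τℤ` for `1 - k ≤ j ≤ k - 1`
and `(γ + δ + j)/r ∉ ℤ + τℤ` for `0 ≤ j ≤ k - 1`. -/
def IsGeneric (τ r : ℂ) (k : ℕ) (γ δ : ℂ) : Prop :=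
  (∀ j : ℤ, 1 - (k : ℤ) ≤ j → j ≤ (k : ℤ) - 1 →
    ∀ s t : ℤ, (γ - δ + j) / r ≠ s + t * τ) ∧
  (∀ j : ℤ, 0 ≤ j → j ≤ (k : ℤ) - 1 →
    ∀ s t : ℤ, (γ + δ + j) / r ≠ s + t * τ)

open Classical in
/-- The elliptic `6j`-symbol `R_n^m(α, β, γ, δ; k)`: the coefficient of `e_m^k(z; γ, δ)` in the
expansion `e_n^k(z; α, β) = ∑_{m=0}^k R_n^m(α, β, γ, δ; k) e_m^k(z; γ, δ)`
(and `0` if there is no such expansion). -/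
noncomputable def R (τ r : ℂ) (k : ℕ) (n m : Fin (k + 1)) (α β γ δ : ℂ) : ℂ :=
  if h : ∃ c : Fin (k + 1) → ℂ, ∀ z : ℂ,
      naturalVec τ r k n α β z = ∑ l, c l * naturalVec τ r k l γ δ z
  then h.choose m else 0

/-- The number of ones among the entries of a 0/1 sequence that precede the entry `j`. -/
def onesBefore {k : ℕ} (ν : Fin k → Fin 2) (j : Fin k) : ℕ :=
  ∑ i ∈ Finset.univ.filter (fun i => i < j), (ν i : ℕ)

/-- The number of zeros among the entries of a 0/1 sequence that precede the entry `j`. -/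
def zerosBefore {k : ℕ} (ν : Fin k → Fin 2) (j : Fin k) : ℕ :=
  ∑ i ∈ Finset.univ.filter (fun i => i < j), (1 - (ν i : ℕ))

/-- The 0/1 sequences of length `k` with sum `m`. -/
def pathsWithSum (k m : ℕ) : Finset (Fin k → Fin 2) :=
  Finset.univ.filter (fun ν => ∑ j, (ν j : ℕ) = m)

/-- The `i`-th height of the path that starts at the height `a₀ = a` and whose steps are
`a_{i-1} - a_i = 1 - 2 ν_i`. -/
noncomputable def height {k : ℕ} (a : ℂ) (ν : Fin k → Fin 2) (i : ℕ) : ℂ :=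
  a - ∑ l ∈ Finset.univ.filter (fun l : Fin k => (l : ℕ) < i), (1 - 2 * ((ν l : ℕ) : ℂ))

end Elliptic6j

/-! The vectors factor along paths: for `i ∈ {0, 1}`, `e_{i+n}^{k+1}(z; α, β) = e_i^1(z; α, β)
e_n^k(z; α + i, β + 1 - i)` (`shiftedFactorialPM_mul_step`). Expand the level-one factor over
`e_m^1(z; γ, δ)`, and for each `m` expand the other factor at `(γ + m, δ + 1 - m)`: the same
factorization, read backwards, reassembles vectors of level `k + 1` at `(γ, δ)`. Induction on `k`
gives a sum over all paths (`fusion_expansion`). Grouping paths by their sum and comparing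
coefficients gives the theorem.

Two facts support this. The level-one expansion is the three-term addition formula for the bracket.
Linear independence, which makes coefficients comparable, follows by evaluating at `z = δ/r`, where
only the top vector survives, and dividing `[δ ± rz]` out of the rest.

Nonvanishing of `ϑ₁` off the lattice is read off its product. Its continuity and addition formula
come from its series, so the product is first converted to `jacobiTheta₂` by the Jacobi triple
product identity. -/

namespace Elliptic6j
open Filter Topology

/-! ### Gaussian binomials and the finite `q`-binomial theorem -/

/-- The finite `q`-Pochhammer symbol `(q;q)_n`. -/
noncomputable def qFactorial (q : ℂ) (n : ℕ) : ℂ := ∏ i ∈ Finset.range n, (1 - q ^ (i + 1))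

/-- The Gaussian binomial coefficient, equal to `0` for `n < j`. -/
noncomputable def gaussBinom (q : ℂ) (n j : ℕ) : ℂ :=
  if j ≤ n then qFactorial q n / (qFactorial q j * qFactorial q (n - j)) else 0

lemma qFactorial_succ (q : ℂ) (n : ℕ) :
    qFactorial q (n + 1) = qFactorial q n * (1 - q ^ (n + 1)) :=
  Finset.prod_range_succ _ _

lemma one_sub_pow_ne_zero {q : ℂ} (hq : ‖q‖ < 1) (n : ℕ) : 1 - q ^ (n + 1) ≠ 0 := by
  intro h
  have h1 : ‖q ^ (n + 1)‖ = 1 := by rw [← sub_eq_zero.mp h]; simp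
  rw [norm_pow] at h1
  exact (pow_lt_one₀ (norm_nonneg q) hq n.succ_ne_zero).ne h1

lemma qFactorial_ne_zero {q : ℂ} (hq : ‖q‖ < 1) (n : ℕ) : qFactorial q n ≠ 0 :=
  Finset.prod_ne_zero_iff.mpr fun i _ => one_sub_pow_ne_zero hq i

lemma gaussBinom_zero_right {q : ℂ} (hq : ‖q‖ < 1) (n : ℕ) : gaussBinom q n 0 = 1 := by
  have := qFactorial_ne_zero hq n
  rw [gaussBinom, if_pos n.zero_le, Nat.sub_zero, show qFactorial q 0 = 1 from rfl, one_mul]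
  exact div_self this

/-- The Pascal recurrence for Gaussian binomial coefficients. -/
lemma gaussBinom_succ_succ {q : ℂ} (hq : ‖q‖ < 1) {n j : ℕ} (hj : j ≤ n) :
    gaussBinom q (n + 1) (j + 1) = gaussBinom q n (j + 1) + q ^ (n - j) * gaussBinom q n j := by
  obtain ⟨d, rfl⟩ := Nat.exists_eq_add_of_le hj
  have hf := qFactorial_ne_zero hq
  have h1 := one_sub_pow_ne_zero hq
  -- For `j = n` the coefficient `gaussBinom q n (n + 1)` takes its default value `0`, so the
  -- quotient formula does not apply to it.
  rcases d with _ | d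
  · have := hf j
    have := hf (j + 1)
    simp [gaussBinom, qFactorial] at *
    field_simp
  · have e1 : j + (d + 1) + 1 - (j + 1) = d + 1 := by omega
    have e2 : j + (d + 1) - (j + 1) = d := by omega
    have e3 : j + (d + 1) - j = d + 1 := by omega
    rw [gaussBinom, gaussBinom, gaussBinom, if_pos (by omega), if_pos (by omega), if_pos (by omega),
      e1, e2, e3, qFactorial_succ q (j + (d + 1)), qFactorial_succ q j, qFactorial_succ q d]
    have := hf (j + (d + 1))
    have := hf j
    have := hf d
    have := h1 j
    have := h1 d
    field_simp
    ring

/-- The finite `q`-binomial theorem. -/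
lemma prod_one_add_mul_pow {q : ℂ} (hq : ‖q‖ < 1) (x : ℂ) (n : ℕ) :
    ∏ i ∈ Finset.range n, (1 + x * q ^ i)
      = ∑ j ∈ Finset.range (n + 1), gaussBinom q n j * (q ^ j.choose 2 * x ^ j) := by
  induction n with
  | zero => simp [gaussBinom, qFactorial]
  | succ n ih =>
    rw [Finset.prod_range_succ, ih, mul_add, mul_one, Finset.sum_range_succ' _ (n + 1)]
    -- The sum can be lengthened by one index because the coefficient at `j = n + 1` is `0`. After
    -- the shift it lines up with the Pascal recurrence.
    have h1 : ∑ j ∈ Finset.range (n + 1), gaussBinom q n j * (q ^ j.choose 2 * x ^ j)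
        = ∑ j ∈ Finset.range (n + 1),
            gaussBinom q n (j + 1) * (q ^ (j + 1).choose 2 * x ^ (j + 1))
          + gaussBinom q n 0 * (q ^ (0 : ℕ).choose 2 * x ^ 0) := by
      rw [← Finset.sum_range_succ' (fun j => gaussBinom q n j * (q ^ j.choose 2 * x ^ j)),
        Finset.sum_range_succ _ (n + 1)]
      simp [gaussBinom]
    conv_lhs => arg 1; rw [h1]
    rw [gaussBinom_zero_right hq, gaussBinom_zero_right hq, add_right_comm, Finset.sum_mul,
      ← Finset.sum_add_distrib]
    congr 1
    refine Finset.sum_congr rfl fun j hj => ?_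
    have hj' : j ≤ n := by simpa [Nat.lt_succ_iff] using hj
    rw [gaussBinom_succ_succ hq hj', Nat.choose_succ_succ' j 1, Nat.choose_one_right]
    have : q ^ n = q ^ (n - j) * q ^ j := by rw [← pow_add, Nat.sub_add_cancel hj']
    rw [this]
    ring

/-! ### Infinite `q`-products and limits of Gaussian binomials -/

lemma multipliable_one_sub_pow_mul {q : ℂ} (hq : ‖q‖ < 1) (w : ℂ) :
    Multipliable fun n : ℕ => 1 - q ^ (n + 1) * w := by
  have : Summable fun n : ℕ => ‖-(q ^ (n + 1) * w)‖ := by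
    simp only [norm_neg, norm_mul, norm_pow]
    exact ((summable_geometric_of_lt_one (norm_nonneg q) hq).comp_injective
      (add_left_injective 1)).mul_right _
  simpa [sub_eq_add_neg] using multipliable_one_add_of_summable this

lemma tprod_one_sub_pow_mul_ne_zero {q : ℂ} (hq : ‖q‖ < 1) {w : ℂ}
    (hw : ∀ n : ℕ, 1 - q ^ (n + 1) * w ≠ 0) : ∏' n : ℕ, (1 - q ^ (n + 1) * w) ≠ 0 := by
  have : Summable fun n : ℕ => ‖-(q ^ (n + 1) * w)‖ := by
    simp only [norm_neg, norm_mul, norm_pow]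
    exact ((summable_geometric_of_lt_one (norm_nonneg q) hq).comp_injective
      (add_left_injective 1)).mul_right _
  simpa [sub_eq_add_neg] using tprod_one_add_ne_zero_of_summable
    (f := fun n : ℕ => -(q ^ (n + 1) * w)) (by simpa [sub_eq_add_neg] using hw) this

lemma tendsto_qFactorial {q : ℂ} (hq : ‖q‖ < 1) :
    Tendsto (qFactorial q) atTop (𝓝 (∏' n : ℕ, (1 - q ^ (n + 1)))) := by
  have := (multipliable_one_sub_pow_mul hq 1).hasProd.tendsto_prod_nat
  simp only [mul_one] at this
  exact this

lemma tprod_one_sub_pow_ne_zero {q : ℂ} (hq : ‖q‖ < 1) : ∏' n : ℕ, (1 - q ^ (n + 1)) ≠ 0 := by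
  simpa using tprod_one_sub_pow_mul_ne_zero hq (w := 1) (by simpa using one_sub_pow_ne_zero hq)

/-- Since `(q;q)_n` converges to a nonzero limit, it and its inverse are bounded. The uniform bound
is the majorant for dominated convergence in the triple product. -/
lemma exists_gaussBinom_bound {q : ℂ} (hq : ‖q‖ < 1) :
    ∃ B : ℝ, ∀ n j, ‖gaussBinom q n j‖ ≤ B := by
  obtain ⟨B, hB⟩ := (tendsto_qFactorial hq).norm.bddAbove_range
  obtain ⟨D, hD⟩ := ((tendsto_qFactorial hq).inv₀ (tprod_one_sub_pow_ne_zero hq)).norm.bddAbove_range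
  have hB' : ∀ n, ‖qFactorial q n‖ ≤ B := fun n => hB ⟨n, rfl⟩
  have hD' : ∀ n, ‖(qFactorial q n)⁻¹‖ ≤ D := fun n => hD ⟨n, rfl⟩
  have hB0 : 0 ≤ B := (norm_nonneg _).trans (hB' 0)
  have hD0 : 0 ≤ D := (norm_nonneg _).trans (hD' 0)
  refine ⟨B * (D * D), fun n j => ?_⟩
  rw [gaussBinom]
  split_ifs
  · rw [div_eq_mul_inv, mul_inv, norm_mul, norm_mul]
    exact mul_le_mul (hB' _) (mul_le_mul (hD' _) (hD' _) (norm_nonneg _) hD0) (by positivity) hB0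
  · rw [norm_zero]; positivity

/-- Near the middle of row `2N + 1` all three Pochhammer indices tend to infinity, leaving `P / (P *
P)`. -/
lemma tendsto_gaussBinom {q : ℂ} (hq : ‖q‖ < 1) (n : ℤ) :
    Tendsto (fun N : ℕ => gaussBinom q (2 * N + 1) (n + N).toNat) atTop
      (𝓝 (∏' n : ℕ, (1 - q ^ (n + 1)))⁻¹) := by
  have ht := tendsto_qFactorial hq
  have h0 := tprod_one_sub_pow_ne_zero hq
  set P := ∏' n : ℕ, (1 - q ^ (n + 1))
  have e : P⁻¹ = P / (P * P) := by field_simp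
  rw [e]
  have t1 : Tendsto (fun N : ℕ => 2 * N + 1) atTop atTop :=
    tendsto_atTop_atTop.mpr fun b => ⟨b, fun a ha => by omega⟩
  have t2 : Tendsto (fun N : ℕ => (n + N).toNat) atTop atTop :=
    tendsto_atTop_atTop.mpr fun b => ⟨b + n.natAbs, fun a ha => by omega⟩
  have t3 : Tendsto (fun N : ℕ => 2 * N + 1 - (n + N).toNat) atTop atTop :=
    tendsto_atTop_atTop.mpr fun b => ⟨b + n.natAbs, fun a ha => by omega⟩
  refine ((ht.comp t1).div ((ht.comp t2).mul (ht.comp t3)) (mul_ne_zero h0 h0)).congr' ?_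
  filter_upwards [eventually_ge_atTop n.natAbs] with N hN
  rw [gaussBinom, if_pos (by omega)]
  rfl

end Elliptic6j
namespace Elliptic6j
open Filter Topology

/-! ### The Jacobi triple product -/

/-- A finite form of the Jacobi triple product identity. -/
lemma prod_eq_sum_gaussBinom {q w : ℂ} (hq : ‖q‖ < 1) (hq0 : q ≠ 0) (hw : w ≠ 0) (N : ℕ) :
    (1 - w) * (∏ i ∈ Finset.range N, (1 - q ^ (i + 1) * w))
        * ∏ i ∈ Finset.range N, (1 - q ^ (i + 1) * w⁻¹)
      = ∑ j ∈ Finset.range (2 * N + 2), gaussBinom q (2 * N + 1) j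
          * (q ^ (N + 1).choose 2 * (-w)⁻¹ ^ N * (q ^ j.choose 2 * (-w / q ^ N) ^ j)) := by
  -- This substitution centres the product: its factors are `1 - w q^(i - N)`. Those with negative
  -- exponent become factors in `w⁻¹` once `-w q^(-(i + 1))` is pulled out.
  have h := prod_one_add_mul_pow hq (-w / q ^ N) (2 * N + 1)
  have e1 : ∏ i ∈ Finset.range (2 * N + 1), (1 + -w / q ^ N * q ^ i)
      = (∏ i ∈ Finset.range N, (1 - q ^ (i + 1) * w⁻¹) * (-w) * (q ^ (i + 1))⁻¹)
        * ((1 - w) * ∏ i ∈ Finset.range N, (1 - q ^ (i + 1) * w)) := by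
    rw [show 2 * N + 1 = N + (N + 1) by ring, Finset.prod_range_add, Finset.prod_range_succ',
      ← Finset.prod_range_reflect, mul_comm (1 - w)]
    congr 1
    · refine Finset.prod_congr rfl fun i hi => ?_
      have hi' : i < N := by simpa using hi
      have : q ^ N = q ^ (N - 1 - i) * q ^ (i + 1) := by rw [← pow_add]; congr 1; omega
      rw [this]
      field_simp
      ring
    · congr 1
      · refine Finset.prod_congr rfl fun i hi => ?_
        rw [pow_add]
        field_simp
        ring
      · field_simp
        ring
  have e2 : ∀ N,  ∏ i ∈ Finset.range N, q ^ (i + 1) = q ^ (N + 1).choose 2 := by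
    intro N
    induction N with
    | zero => simp
    | succ N ih =>
      rw [Finset.prod_range_succ, ih, ← pow_add, Nat.choose_succ_succ' (N + 1) 1,
        Nat.choose_one_right, add_comm]
  rw [e1] at h
  simp only [Finset.prod_mul_distrib, Finset.prod_const, Finset.card_range, Finset.prod_inv_distrib,
    e2] at h
  have hz : q ^ (N + 1).choose 2 ≠ 0 := pow_ne_zero _ hq0
  have hn : (-w) ≠ 0 := neg_ne_zero.mpr hw
  have e3 : (-w) ^ N * (-w)⁻¹ ^ N = 1 := by rw [← mul_pow, mul_inv_cancel₀ hn, one_pow]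
  rw [show 2 * N + 2 = 2 * N + 1 + 1 by ring]
  have e4 : ∀ j, gaussBinom q (2 * N + 1) j
      * (q ^ (N + 1).choose 2 * (-w)⁻¹ ^ N * (q ^ j.choose 2 * (-w / q ^ N) ^ j))
      = q ^ (N + 1).choose 2 * (-w)⁻¹ ^ N
        * (gaussBinom q (2 * N + 1) j * (q ^ j.choose 2 * (-w / q ^ N) ^ j)) := fun j => by ring
  rw [Finset.sum_congr rfl fun j _ => e4 j, ← Finset.mul_sum, ← h]
  have hz' := mul_inv_cancel₀ hz
  generalize q ^ (N + 1).choose 2 = z at hz' ⊢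
  generalize z⁻¹ = z' at hz' ⊢
  generalize (-w) ^ N = W at e3 ⊢
  generalize (-w)⁻¹ ^ N = W' at e3 ⊢
  linear_combination (-(1 - w) * (∏ i ∈ Finset.range N, (1 - q ^ (i + 1) * w))
    * ∏ i ∈ Finset.range N, (1 - q ^ (i + 1) * w⁻¹)) * (z * z' * e3 + hz')

end Elliptic6j
namespace Elliptic6j
open Filter Topology Complex

/-- The nome `exp(2πiτ)` has norm less than one on the upper half-plane. -/
lemma norm_exp_two_pi_I_mul_lt_one {τ : ℂ} (hτ : 0 < τ.im) :
    ‖exp (2 * Real.pi * I * τ)‖ < 1 := by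
  rw [norm_exp, Real.exp_lt_one_iff]
  have : (2 * Real.pi * I * τ).re = -(2 * Real.pi * τ.im) := by simp
  rw [this]
  have := Real.pi_pos
  have : 0 < 2 * Real.pi * τ.im := by positivity
  linarith

/-- Apart from the Gaussian binomial, the summand of the finite identity depends only on `j - N`,
which makes a termwise limit possible. -/
lemma pow_mul_pow_eq_jacobiTheta₂_term (τ u : ℂ) (N j : ℕ) :
    exp (2 * Real.pi * I * τ) ^ (N + 1).choose 2 * (-exp (2 * Real.pi * I * u))⁻¹ ^ N
      * (exp (2 * Real.pi * I * τ) ^ j.choose 2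
        * (-exp (2 * Real.pi * I * u) / exp (2 * Real.pi * I * τ) ^ N) ^ j)
      = jacobiTheta₂_term ((j : ℤ) - N) (u + 1 / 2 - τ / 2) τ := by
  have e : -exp (2 * Real.pi * I * u) = exp (2 * Real.pi * I * u + Real.pi * I) := by
    rw [exp_add, exp_pi_mul_I]; ring
  rw [e, ← exp_neg, jacobiTheta₂_term]
  simp only [← exp_nat_mul, ← exp_sub, ← exp_add, Nat.cast_choose_two]
  congr 1
  push_cast
  ring

/-- The **Jacobi triple product identity**. -/
theorem jacobi_triple_product {τ : ℂ} (hτ : 0 < τ.im) (u : ℂ) :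
    (∏' n : ℕ, (1 - exp (2 * Real.pi * I * τ) ^ (n + 1)))
      * ((1 - exp (2 * Real.pi * I * u))
        * (∏' n : ℕ, (1 - exp (2 * Real.pi * I * τ) ^ (n + 1) * exp (2 * Real.pi * I * u)))
        * ∏' n : ℕ, (1 - exp (2 * Real.pi * I * τ) ^ (n + 1) * (exp (2 * Real.pi * I * u))⁻¹))
      = jacobiTheta₂ (u + 1 / 2 - τ / 2) τ := by
  have hq := norm_exp_two_pi_I_mul_lt_one hτ
  have hq0 : exp (2 * Real.pi * I * τ) ≠ 0 := exp_ne_zero _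
  have hw : exp (2 * Real.pi * I * u) ≠ 0 := exp_ne_zero _
  have hterm := pow_mul_pow_eq_jacobiTheta₂_term τ u
  set q := exp (2 * Real.pi * I * τ)
  set w := exp (2 * Real.pi * I * u)
  set t : ℤ → ℂ := fun n => jacobiTheta₂_term n (u + 1 / 2 - τ / 2) τ with ht
  -- The finite sum is spread over `ℤ` by `n = j - N`. The lower cutoff must be explicit because
  -- `toNat` sends negative integers to `0`; the upper one is the default value of `gaussBinom`.
  let T : ℕ → ℤ → ℂ := fun N n =>
    if -(N : ℤ) ≤ n then gaussBinom q (2 * N + 1) (n + N).toNat * t n else 0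
  have hsum : ∀ N : ℕ, (1 - w) * (∏ i ∈ Finset.range N, (1 - q ^ (i + 1) * w))
      * ∏ i ∈ Finset.range N, (1 - q ^ (i + 1) * w⁻¹) = ∑' n, T N n := by
    intro N
    rw [prod_eq_sum_gaussBinom hq hq0 hw]
    have hinj : Function.Injective fun j : ℕ => (j : ℤ) - N := fun a b h => by
      simpa using h
    rw [← hinj.tsum_eq, tsum_eq_sum (s := Finset.range (2 * N + 2))]
    · refine Finset.sum_congr rfl fun j _ => ?_
      simp only [T, hterm, ht]
      rw [if_pos (by omega), sub_add_cancel, Int.toNat_natCast]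
    · intro j hj
      have : ¬ j ≤ 2 * N + 1 := by simpa [Nat.lt_succ_iff] using hj
      simp only [T]
      rw [if_pos (by omega), sub_add_cancel, Int.toNat_natCast, gaussBinom, if_neg this, zero_mul]
    · intro n hn
      have : -(N : ℤ) ≤ n := by
        by_contra h
        exact hn (if_neg h)
      exact ⟨(n + N).toNat, by simp only; omega⟩
  obtain ⟨B, hB⟩ := exists_gaussBinom_bound hq
  have hB0 : 0 ≤ B := (norm_nonneg _).trans (hB 0 0)
  have hst : Summable t := (summable_jacobiTheta₂_term_iff _ τ).mpr hτ
  have hlim : Tendsto (fun N => ∑' n, T N n) atTop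
      (𝓝 (∑' n, (∏' n : ℕ, (1 - q ^ (n + 1)))⁻¹ * t n)) := by
    refine tendsto_tsum_of_dominated_convergence (bound := fun n => B * ‖t n‖)
      (hst.norm.mul_left B) (fun n => ?_) (Eventually.of_forall fun N n => ?_)
    · refine ((tendsto_gaussBinom hq n).mul_const (t n)).congr' ?_
      filter_upwards [eventually_ge_atTop n.natAbs] with N hN
      exact (if_pos (by omega)).symm
    · simp only [T]
      split_ifs
      · rw [norm_mul]
        exact mul_le_mul_of_nonneg_right (hB _ _) (norm_nonneg _)
      · rw [norm_zero]; positivity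
  have hlim' := (((multipliable_one_sub_pow_mul hq w).hasProd.tendsto_prod_nat.const_mul
    (1 - w)).mul (multipliable_one_sub_pow_mul hq w⁻¹).hasProd.tendsto_prod_nat).congr hsum
  rw [tendsto_nhds_unique hlim' hlim, tsum_mul_left, ← mul_assoc,
    mul_inv_cancel₀ (tprod_one_sub_pow_ne_zero hq), one_mul]
  rfl

/-! ### `ϑ₁` as a theta series, and its nonvanishing -/

lemma theta₁_factor (q u : ℂ) (n : ℕ) :
    1 - 2 * q ^ (n + 1) * cos (2 * Real.pi * u) + q ^ (2 * (n + 1))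
      = (1 - q ^ (n + 1) * exp (2 * Real.pi * I * u))
        * (1 - q ^ (n + 1) * (exp (2 * Real.pi * I * u))⁻¹) := by
  rw [cos, show 2 * Real.pi * u * I = 2 * Real.pi * I * u by ring,
    show -(2 * Real.pi * u) * I = -(2 * Real.pi * I * u) by ring, exp_neg]
  have : exp (2 * Real.pi * I * u) ≠ 0 := exp_ne_zero _
  field_simp
  ring

lemma theta₁_tprod {τ : ℂ} (hτ : 0 < τ.im) (u : ℂ) :
    ∏' n : ℕ, (1 - 2 * exp (2 * Real.pi * I * τ) ^ (n + 1) * cos (2 * Real.pi * u)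
        + exp (2 * Real.pi * I * τ) ^ (2 * (n + 1)))
      = (∏' n : ℕ, (1 - exp (2 * Real.pi * I * τ) ^ (n + 1) * exp (2 * Real.pi * I * u)))
        * ∏' n : ℕ, (1 - exp (2 * Real.pi * I * τ) ^ (n + 1) * (exp (2 * Real.pi * I * u))⁻¹) := by
  have hq := norm_exp_two_pi_I_mul_lt_one hτ
  rw [← (multipliable_one_sub_pow_mul hq _).tprod_mul (multipliable_one_sub_pow_mul hq _)]
  exact tprod_congr fun n => theta₁_factor _ _ _

/-- `ϑ₁` expressed through the two-variable Jacobi theta function. -/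
lemma theta₁_eq_jacobiTheta₂ {τ : ℂ} (hτ : 0 < τ.im) (u : ℂ) :
    theta₁ τ u = I * exp (2 * Real.pi * I * τ / 8) * exp (-(Real.pi * I * u))
      * jacobiTheta₂ (u + 1 / 2 - τ / 2) τ := by
  have hs : sin (Real.pi * u)
      = I / 2 * exp (-(Real.pi * I * u)) * (1 - exp (2 * Real.pi * I * u)) := by
    rw [sin, show -(Real.pi * u) * I = -(Real.pi * I * u) by ring,
      show Real.pi * u * I = -(Real.pi * I * u) + 2 * Real.pi * I * u by ring, exp_add]
    ring
  rw [theta₁, theta₁_tprod hτ, ← jacobi_triple_product hτ, hs]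
  ring

lemma theta₁_zero (τ : ℂ) : theta₁ τ 0 = 0 := by simp [theta₁]

lemma continuous_theta₁ {τ : ℂ} (hτ : 0 < τ.im) : Continuous (theta₁ τ) := by
  have h : theta₁ τ = fun u => I * exp (2 * Real.pi * I * τ / 8) * exp (-(Real.pi * I * u))
      * jacobiTheta₂ (u + 1 / 2 - τ / 2) τ := funext (theta₁_eq_jacobiTheta₂ hτ)
  have hj : Continuous fun z => jacobiTheta₂ z τ := continuous_iff_continuousAt.mpr fun z =>
    (differentiableAt_jacobiTheta₂_fst z hτ).continuousAt
  rw [h]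
  exact (by fun_prop : Continuous fun u => I * exp (2 * Real.pi * I * τ / 8)
    * exp (-(Real.pi * I * u))).mul (hj.comp (by fun_prop))

/-- `ϑ₁` does not vanish off the lattice `ℤ + τℤ`. -/
lemma theta₁_ne_zero {τ : ℂ} (hτ : 0 < τ.im) {u : ℂ} (hu : ∀ s t : ℤ, u ≠ s + t * τ) :
    theta₁ τ u ≠ 0 := by
  have hq := norm_exp_two_pi_I_mul_lt_one hτ
  have hpi : (2 * Real.pi * I : ℂ) ≠ 0 := two_pi_I_ne_zero
  rw [theta₁, theta₁_tprod hτ]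
  -- The sine accounts for the lattice points with `t = 0`, the two infinite products for those with
  -- `t < 0` and `t > 0`.
  refine mul_ne_zero (mul_ne_zero (mul_ne_zero (mul_ne_zero two_ne_zero (exp_ne_zero _))
    (tprod_one_sub_pow_ne_zero hq)) ?_) (mul_ne_zero ?_ ?_)
  · rw [Ne, sin_eq_zero_iff]
    rintro ⟨s, hs⟩
    refine hu s 0 ?_
    have : (Real.pi : ℂ) ≠ 0 := ofReal_ne_zero.mpr Real.pi_ne_zero
    rw [mul_comm] at hs
    simpa using mul_right_cancel₀ this hs
  · refine tprod_one_sub_pow_mul_ne_zero hq fun n h => ?_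
    rw [← exp_nat_mul, ← exp_add, sub_eq_zero, eq_comm, exp_eq_one_iff] at h
    obtain ⟨s, hs⟩ := h
    refine hu s (-(n + 1 : ℕ)) (mul_left_cancel₀ hpi ?_)
    push_cast at hs ⊢
    linear_combination hs
  · refine tprod_one_sub_pow_mul_ne_zero hq fun n h => ?_
    rw [← exp_nat_mul, ← exp_neg, ← exp_add, sub_eq_zero, eq_comm, exp_eq_one_iff] at h
    obtain ⟨s, hs⟩ := h
    refine hu (-s) ((n + 1 : ℕ)) (mul_left_cancel₀ hpi ?_)
    push_cast at hs ⊢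
    linear_combination -hs

/-! ### The addition formula for `ϑ₁` -/

lemma exp_add_int_mul_two_pi_I (y : ℂ) (m : ℤ) : exp (y + m * (2 * Real.pi * I)) = exp y := by
  rw [exp_add, exp_int_mul_two_pi_mul_I, mul_one]

lemma exp_add_pi_I (y : ℂ) : exp (y + Real.pi * I) = -exp y := by
  rw [exp_add, exp_pi_mul_I]; ring

/-- Passing to `(n + m - 1, n - m)` diagonalizes the quadratic form. These indices have opposite
parity, so the two products on the right are negatives of each other, which produces the factor `2`.
-/
lemma two_mul_theta₁_term_mul (τ x z : ℂ) (n m : ℤ) :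
    2 * ((I * exp (2 * Real.pi * I * τ / 8) * exp (-(Real.pi * I * (x + z)))
        * jacobiTheta₂_term n (x + z + 1 / 2 - τ / 2) τ)
      * (I * exp (2 * Real.pi * I * τ / 8) * exp (-(Real.pi * I * (x - z)))
        * jacobiTheta₂_term m (x - z + 1 / 2 - τ / 2) τ))
      = jacobiTheta₂_term (n + m - 1) (x + 1 / 2) (τ / 2) * jacobiTheta₂_term (n - m) z (τ / 2)
        - jacobiTheta₂_term (n + m - 1) x (τ / 2)
          * jacobiTheta₂_term (n - m) (z + 1 / 2) (τ / 2) := by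
  simp only [jacobiTheta₂_term, ← exp_add]
  set S := 2 * Real.pi * I * ((n + m - 1 : ℤ) : ℂ) * (x + 1 / 2)
    + Real.pi * I * ((n + m - 1 : ℤ) : ℂ) ^ 2 * (τ / 2)
    + (2 * Real.pi * I * ((n - m : ℤ) : ℂ) * z + Real.pi * I * ((n - m : ℤ) : ℂ) ^ 2 * (τ / 2)) with hS
  have h2 : exp (2 * Real.pi * I * ((n + m - 1 : ℤ) : ℂ) * x
      + Real.pi * I * ((n + m - 1 : ℤ) : ℂ) ^ 2 * (τ / 2)
      + (2 * Real.pi * I * ((n - m : ℤ) : ℂ) * (z + 1 / 2)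
        + Real.pi * I * ((n - m : ℤ) : ℂ) ^ 2 * (τ / 2))) = -exp S := by
    rw [← exp_add_pi_I, ← exp_add_int_mul_two_pi_I _ m, hS]
    congr 1
    push_cast
    ring
  have h1 : exp S = -exp (2 * Real.pi * I * τ / 8 + -(Real.pi * I * (x + z))
      + (2 * Real.pi * I * n * (x + z + 1 / 2 - τ / 2) + Real.pi * I * n ^ 2 * τ)
      + (2 * Real.pi * I * τ / 8 + -(Real.pi * I * (x - z))
      + (2 * Real.pi * I * m * (x - z + 1 / 2 - τ / 2) + Real.pi * I * m ^ 2 * τ))) := by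
    rw [eq_neg_iff_add_eq_zero, add_comm, ← eq_neg_iff_add_eq_zero, ← exp_add_pi_I, hS]
    congr 1
    push_cast
    ring
  rw [h2, h1]
  simp only [exp_add]
  ring_nf
  rw [I_sq]
  ring

/-- A half shift multiplies a term by `-1` to its index, so indices of equal parity contribute equal
signs and cancel in the determinant. -/
lemma jacobiTheta₂_term_mul_comm_of_even (τ x z : ℂ) (b m : ℤ) :
    jacobiTheta₂_term (b + 2 * m) (x + 1 / 2) τ * jacobiTheta₂_term b z τ
      = jacobiTheta₂_term (b + 2 * m) x τ * jacobiTheta₂_term b (z + 1 / 2) τ := by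
  simp only [jacobiTheta₂_term, ← exp_add]
  rw [← exp_add_int_mul_two_pi_I (_ + (2 * Real.pi * I * b * (z + 1 / 2) + _)) m]
  congr 1
  push_cast
  ring

/-- The product `ϑ₁(x + z) ϑ₁(x - z)` as a two by two determinant in theta functions of the
half period. -/
lemma theta₁_add_mul_theta₁_sub {τ : ℂ} (hτ : 0 < τ.im) (x z : ℂ) :
    2 * (theta₁ τ (x + z) * theta₁ τ (x - z))
      = jacobiTheta₂ (x + 1 / 2) (τ / 2) * jacobiTheta₂ z (τ / 2)
        - jacobiTheta₂ x (τ / 2) * jacobiTheta₂ (z + 1 / 2) (τ / 2) := by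
  have hτ2 : 0 < (τ / 2).im := by simpa using hτ
  have hs : ∀ {σ : ℂ}, 0 < σ.im → ∀ y, Summable fun n => ‖jacobiTheta₂_term n y σ‖ :=
    fun h y => ((summable_jacobiTheta₂_term_iff y _).mpr h).norm
  rw [theta₁_eq_jacobiTheta₂ hτ, theta₁_eq_jacobiTheta₂ hτ]
  simp only [jacobiTheta₂]
  rw [← tsum_mul_left, ← tsum_mul_left,
    tsum_mul_tsum_of_summable_norm (by simpa only [norm_mul] using (hs hτ _).mul_left _)
      (by simpa only [norm_mul] using (hs hτ _).mul_left _),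
    tsum_mul_tsum_of_summable_norm (hs hτ2 _) (hs hτ2 _),
    tsum_mul_tsum_of_summable_norm (hs hτ2 _) (hs hτ2 _),
    ← (summable_mul_of_summable_norm (hs hτ2 _) (hs hτ2 _)).tsum_sub
      (summable_mul_of_summable_norm (hs hτ2 _) (hs hτ2 _)), ← tsum_mul_left]
  have hinj : Function.Injective fun p : ℤ × ℤ => (p.1 + p.2 - 1, p.1 - p.2) := by
    rintro ⟨a, b⟩ ⟨c, d⟩ h
    simp only [Prod.mk.injEq] at h ⊢
    omega
  rw [← hinj.tsum_eq (f := fun p : ℤ × ℤ =>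
    jacobiTheta₂_term p.1 (x + 1 / 2) (τ / 2) * jacobiTheta₂_term p.2 z (τ / 2)
      - jacobiTheta₂_term p.1 x (τ / 2) * jacobiTheta₂_term p.2 (z + 1 / 2) (τ / 2))]
  · exact tsum_congr fun p => two_mul_theta₁_term_mul τ x z p.1 p.2
  · rintro ⟨a, b⟩ h
    by_contra hab
    obtain ⟨m, hm⟩ : ∃ m, a = b + 2 * m := by
      rcases Int.even_or_odd' (a - b) with ⟨m, hm | hm⟩
      · exact ⟨m, by omega⟩
      · refine absurd ⟨(b + m + 1, m + 1), ?_⟩ hab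
        simp only [Prod.mk.injEq]
        omega
    subst hm
    exact h (sub_eq_zero.mpr (jacobiTheta₂_term_mul_comm_of_even (τ / 2) x z b m))

/-- The addition formula for `ϑ₁`. -/
theorem theta₁_addition {τ : ℂ} (hτ : 0 < τ.im) (x y w z : ℂ) :
    theta₁ τ (y + w) * theta₁ τ (y - w) * (theta₁ τ (x + z) * theta₁ τ (x - z))
      = theta₁ τ (x + w) * theta₁ τ (x - w) * (theta₁ τ (y + z) * theta₁ τ (y - z))
        - theta₁ τ (x + y) * theta₁ τ (x - y) * (theta₁ τ (w + z) * theta₁ τ (w - z)) := by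
  have h := theta₁_add_mul_theta₁_sub hτ
  have h4 : (4 : ℂ) ≠ 0 := by norm_num
  -- With the factor `4` every pair product becomes a determinant of vectors `(θ(x + 1/2), θ(x))`.
  -- The claim is then the Plücker relation for four vectors in the plane.
  refine mul_left_cancel₀ h4 ?_
  have e : ∀ a b c d : ℂ, 4 * (a * b * (c * d)) = 2 * (a * b) * (2 * (c * d)) := by intros; ring
  rw [mul_sub, e, e, e, h, h, h, h, h, h]
  ring

end Elliptic6j
namespace Elliptic6j

/-! ### The bracket symbol and shifted factorials -/

lemma bracketConst_ne_zero {τ : ℂ} (hτ : 0 < τ.im) : bracketConst τ ≠ 0 := by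
  have h0 : τ ≠ 0 := by rintro rfl; simp at hτ
  refine mul_ne_zero (mul_ne_zero (Complex.exp_ne_zero _) (Complex.exp_ne_zero _)) ?_
  simp [Complex.cpow_eq_zero_iff, h0]

lemma bracket_zero (τ r : ℂ) : bracket τ r 0 = 0 := by simp [bracket, theta₁_zero]

lemma bracket_ne_zero {τ : ℂ} (hτ : 0 < τ.im) {r u : ℂ} (hu : ∀ s t : ℤ, u / r ≠ s + t * τ) :
    bracket τ r u ≠ 0 :=
  mul_ne_zero (bracketConst_ne_zero hτ) (theta₁_ne_zero hτ hu)

@[fun_prop]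
lemma continuous_bracket {τ : ℂ} (hτ : 0 < τ.im) (r : ℂ) : Continuous (bracket τ r) :=
  continuous_const.mul ((continuous_theta₁ hτ).comp (continuous_id.div_const r))

/-- The addition formula for the bracket symbol. -/
lemma bracket_addition {τ : ℂ} (hτ : 0 < τ.im) (r x y w z : ℂ) :
    bracket τ r (y + w) * bracket τ r (y - w) * (bracket τ r (x + z) * bracket τ r (x - z))
      = bracket τ r (x + w) * bracket τ r (x - w) * (bracket τ r (y + z) * bracket τ r (y - z))
        - bracket τ r (x + y) * bracket τ r (x - y)
          * (bracket τ r (w + z) * bracket τ r (w - z)) := by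
  simp only [bracket, add_div, sub_div]
  linear_combination bracketConst τ ^ 4 * theta₁_addition hτ (x / r) (y / r) (w / r) (z / r)

lemma shiftedFactorialPM_zero (τ r α z : ℂ) : shiftedFactorialPM τ r α z 0 = 1 := by
  simp [shiftedFactorialPM, shiftedFactorial]

lemma shiftedFactorialPM_one (τ r α z : ℂ) :
    shiftedFactorialPM τ r α z 1 = bracket τ r (α + r * z) * bracket τ r (α - r * z) := by
  simp [shiftedFactorialPM, shiftedFactorial]

lemma shiftedFactorialPM_succ (τ r α z : ℂ) (n : ℕ) :
    shiftedFactorialPM τ r α z (n + 1)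
      = shiftedFactorialPM τ r α z 1 * shiftedFactorialPM τ r (α + 1) z n := by
  have h : ∀ u v : ℂ, ∏ j ∈ Finset.range n, bracket τ r (u + v + (j + 1 : ℕ))
      = ∏ j ∈ Finset.range n, bracket τ r (u + 1 + v + j) := fun u v =>
    Finset.prod_congr rfl fun j _ => by congr 1; push_cast; ring
  have h' : ∀ u v : ℂ, ∏ j ∈ Finset.range n, bracket τ r (u - v + (j + 1 : ℕ))
      = ∏ j ∈ Finset.range n, bracket τ r (u + 1 - v + j) := fun u v =>
    Finset.prod_congr rfl fun j _ => by congr 1; push_cast; ring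
  rw [shiftedFactorialPM_one]
  simp only [shiftedFactorialPM, shiftedFactorial, Finset.prod_range_succ', h, h', Nat.cast_zero,
    add_zero]
  ring

lemma continuous_shiftedFactorialPM {τ : ℂ} (hτ : 0 < τ.im) (r α : ℂ) (n : ℕ) :
    Continuous fun z => shiftedFactorialPM τ r α z n := by
  have := continuous_bracket hτ r
  unfold shiftedFactorialPM shiftedFactorial
  fun_prop

/-- The factor `[α ± rz]` vanishes for at most countably many `z`. -/
lemma dense_shiftedFactorialPM_one_ne_zero {τ : ℂ} (hτ : 0 < τ.im) {r : ℂ} (hr : r ≠ 0) (α : ℂ) :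
    Dense {z | shiftedFactorialPM τ r α z 1 ≠ 0} := by
  let S : Set ℂ := Set.range (fun p : ℤ × ℤ => (p.1 + p.2 * τ : ℂ) - α / r)
    ∪ Set.range fun p : ℤ × ℤ => α / r - (p.1 + p.2 * τ : ℂ)
  have hS : S.Countable := (Set.countable_range _).union (Set.countable_range _)
  refine (hS.dense_compl ℂ).mono fun z hz => ?_
  rw [Set.mem_ofPred_eq, shiftedFactorialPM_one]
  refine mul_ne_zero (bracket_ne_zero hτ fun s t h => hz (Or.inl ⟨(s, t), ?_⟩))
    (bracket_ne_zero hτ fun s t h => hz (Or.inr ⟨(s, t), ?_⟩))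
  · rw [add_div, mul_div_cancel_left₀ _ hr] at h
    simp only [← h]; ring
  · rw [sub_div, mul_div_cancel_left₀ _ hr] at h
    simp only [← h]; ring

/-! ### Genericity and linear independence -/

lemma IsGeneric.bracket_sub_ne_zero {τ r γ δ : ℂ} {k : ℕ} (hτ : 0 < τ.im)
    (h : IsGeneric τ r k γ δ) {j : ℕ} (hj : j < k) : bracket τ r (γ - δ + j) ≠ 0 :=
  bracket_ne_zero hτ fun s t => by simpa using h.1 j (by omega) (by omega) s t

lemma IsGeneric.bracket_add_ne_zero {τ r γ δ : ℂ} {k : ℕ} (hτ : 0 < τ.im)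
    (h : IsGeneric τ r k γ δ) {j : ℕ} (hj : j < k) : bracket τ r (γ + δ + j) ≠ 0 :=
  bracket_ne_zero hτ fun s t => by simpa using h.2 j (by omega) (by omega) s t

/-- Genericity is inherited by parameters that are shifted along a path. -/
lemma IsGeneric.shift {τ r γ δ : ℂ} {k : ℕ} (h : IsGeneric τ r k γ δ) {l a b : ℕ}
    (hl : l + a + b ≤ k) : IsGeneric τ r l (γ + a) (δ + b) := by
  refine ⟨fun j h1 h2 s t => ?_, fun j h1 h2 s t => ?_⟩
  · have := h.1 (j + a - b) (by omega) (by omega) s t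
    push_cast at this
    rwa [show γ + a - (δ + b) + j = γ - δ + (j + a - b) by ring]
  · have := h.2 (j + a + b) (by omega) (by omega) s t
    push_cast at this
    rwa [show γ + a + (δ + b) + j = γ + δ + (j + a + b) by ring]

lemma coeff_eq_zero_of_sum_eq_zero {τ r : ℂ} (hτ : 0 < τ.im) (hr : r ≠ 0) {k : ℕ} {γ δ : ℂ}
    (h : IsGeneric τ r k γ δ) {c : ℕ → ℂ}
    (hc : ∀ z, ∑ m ∈ Finset.range (k + 1),
      c m * (shiftedFactorialPM τ r γ z m * shiftedFactorialPM τ r δ z (k - m)) = 0) :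
    ∀ m ≤ k, c m = 0 := by
  induction k generalizing δ with
  | zero =>
    intro m hm
    obtain rfl : m = 0 := by omega
    simpa [shiftedFactorialPM_zero] using hc 0
  | succ k ih =>
    have hsucc : ∀ m ∈ Finset.range (k + 1), ∀ z, shiftedFactorialPM τ r δ z (k + 1 - m)
        = shiftedFactorialPM τ r δ z 1 * shiftedFactorialPM τ r (δ + 1) z (k - m) := by
      intro m hm z
      have : m ≤ k := by simpa [Nat.lt_succ_iff] using hm
      rw [Nat.sub_add_comm this, shiftedFactorialPM_succ]
    -- At `z = δ/r` every vector with `m ≤ k` contains the factor `[δ - rz] = 0`, while genericity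
    -- keeps `[γ ± δ]_{k+1}` nonzero.
    have hlast : c (k + 1) = 0 := by
      have h0 := hc (δ / r)
      have hz : shiftedFactorialPM τ r δ (δ / r) 1 = 0 := by
        rw [shiftedFactorialPM_one, mul_div_cancel₀ _ hr, sub_self, bracket_zero, mul_zero]
      have hnz : shiftedFactorialPM τ r γ (δ / r) (k + 1) ≠ 0 := by
        rw [shiftedFactorialPM, mul_div_cancel₀ _ hr]
        exact mul_ne_zero
          (Finset.prod_ne_zero_iff.mpr fun j hj => h.bracket_add_ne_zero hτ (by simpa using hj))
          (Finset.prod_ne_zero_iff.mpr fun j hj => h.bracket_sub_ne_zero hτ (by simpa using hj))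
      rw [Finset.sum_range_succ, Finset.sum_eq_zero, zero_add, Nat.sub_self,
        shiftedFactorialPM_zero, mul_one] at h0
      · exact (mul_eq_zero.mp h0).resolve_right hnz
      · intro m hm
        rw [hsucc m hm, hz]
        ring
    have hrest : ∀ z, ∑ m ∈ Finset.range (k + 1),
        c m * (shiftedFactorialPM τ r γ z m * shiftedFactorialPM τ r (δ + 1) z (k - m)) = 0 := by
      have hcont : Continuous fun z => ∑ m ∈ Finset.range (k + 1),
          c m * (shiftedFactorialPM τ r γ z m * shiftedFactorialPM τ r (δ + 1) z (k - m)) :=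
        continuous_finsetSum _ fun m _ => continuous_const.mul
          ((continuous_shiftedFactorialPM hτ r γ m).mul
            (continuous_shiftedFactorialPM hτ r (δ + 1) (k - m)))
      -- Division by `[δ ± rz]` is legitimate only where it is nonzero; continuity extends the
      -- result from this dense set.
      refine congrFun (hcont.ext_on (dense_shiftedFactorialPM_one_ne_zero hτ hr δ)
        (continuous_const (y := (0 : ℂ))) fun z hz => ?_)
      refine (mul_eq_zero.mp ?_).resolve_left hz
      have h0 := hc z
      rw [Finset.sum_range_succ, hlast, zero_mul, add_zero] at h0
      rw [← h0, Finset.mul_sum]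
      refine Finset.sum_congr rfl fun m hm => ?_
      rw [hsucc m hm]
      ring
    have hgen : IsGeneric τ r k γ (δ + 1) := by
      simpa using h.shift (l := k) (a := 0) (b := 1) (by omega)
    intro m hm
    rcases hm.lt_or_eq with hm | rfl
    · exact ih hgen hrest m (by omega)
    · exact hlast

/-- The natural basis vectors are linearly independent for generic parameters. -/
theorem linearIndependent_naturalVec {τ r : ℂ} (hτ : 0 < τ.im) (hr : r ≠ 0) {k : ℕ} {γ δ : ℂ}
    (h : IsGeneric τ r k γ δ) :
    LinearIndependent ℂ fun m : Fin (k + 1) => naturalVec τ r k m γ δ := by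
  rw [Fintype.linearIndependent_iff]
  intro g hg i
  have hz := coeff_eq_zero_of_sum_eq_zero hτ hr h
    (c := fun m => if hm : m < k + 1 then g ⟨m, hm⟩ else 0) (fun z => by
      have := congrFun hg z
      simp only [Finset.sum_apply, Pi.smul_apply, smul_eq_mul, Pi.zero_apply] at this
      rw [← this, Finset.sum_range]
      refine Finset.sum_congr rfl fun m _ => ?_
      rw [dif_pos m.isLt]
      rfl) i (Nat.lt_succ_iff.mp i.isLt)
  simpa [Nat.lt_succ_iff.mp i.isLt] using hz

/-! ### Level-one expansion and characterization of the symbols -/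

lemma naturalVec_one_zero (τ r α β z : ℂ) :
    naturalVec τ r 1 0 α β z = shiftedFactorialPM τ r β z 1 := by
  simp [naturalVec, shiftedFactorialPM_zero]

lemma naturalVec_one_one (τ r α β z : ℂ) :
    naturalVec τ r 1 1 α β z = shiftedFactorialPM τ r α z 1 := by
  simp [naturalVec, shiftedFactorialPM_zero]

/-- At level one, every vector expands in the natural basis. -/
lemma exists_expansion_one {τ r : ℂ} (hτ : 0 < τ.im) {γ δ : ℂ} (h : IsGeneric τ r 1 γ δ)
    (x : ℂ) : ∃ c : Fin (1 + 1) → ℂ, ∀ z,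
      shiftedFactorialPM τ r x z 1 = ∑ l, c l * naturalVec τ r 1 l γ δ z := by
  have h1 : bracket τ r (γ - δ) ≠ 0 := by simpa using h.bracket_sub_ne_zero hτ one_pos
  have h2 : bracket τ r (γ + δ) ≠ 0 := by simpa using h.bracket_add_ne_zero hτ one_pos
  set D := bracket τ r (γ + δ) * bracket τ r (γ - δ) with hD
  have hD0 : D ≠ 0 := mul_ne_zero h2 h1
  -- These are the coefficients in the addition formula with `y = γ`, `w = δ`; index `0` belongs to
  -- `[δ ± rz]`.
  refine ⟨![-(bracket τ r (x + γ) * bracket τ r (x - γ)) / D,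
    bracket τ r (x + δ) * bracket τ r (x - δ) / D], fun z => ?_⟩
  rw [Fin.sum_univ_two, naturalVec_one_zero, naturalVec_one_one]
  simp only [shiftedFactorialPM_one, Matrix.cons_val_zero, Matrix.cons_val_one]
  have := bracket_addition hτ r x γ δ (r * z)
  rw [← hD] at this
  field_simp
  linear_combination this

lemma R_spec {τ r : ℂ} {k : ℕ} {n : Fin (k + 1)} {α β γ δ : ℂ}
    (h : ∃ c : Fin (k + 1) → ℂ, ∀ z,
      naturalVec τ r k n α β z = ∑ l, c l * naturalVec τ r k l γ δ z) (z : ℂ) :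
    naturalVec τ r k n α β z = ∑ m, R τ r k n m α β γ δ * naturalVec τ r k m γ δ z := by
  simp only [R, dif_pos h]
  exact h.choose_spec z

lemma naturalVec_one_eq_sum {τ r : ℂ} (hτ : 0 < τ.im) {γ δ : ℂ} (h : IsGeneric τ r 1 γ δ)
    (i : Fin 2) (α β z : ℂ) : naturalVec τ r 1 i α β z
      = ∑ m : Fin 2, R τ r 1 i m α β γ δ * naturalVec τ r 1 m γ δ z := by
  refine R_spec ?_ z
  fin_cases i
  · obtain ⟨c, hc⟩ := exists_expansion_one hτ h β
    exact ⟨c, fun z => (naturalVec_one_zero τ r α β z).trans (hc z)⟩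
  · obtain ⟨c, hc⟩ := exists_expansion_one hτ h α
    exact ⟨c, fun z => (naturalVec_one_one τ r α β z).trans (hc z)⟩

/-- The `6j`-symbols are the coefficients of any expansion in the natural basis. -/
lemma R_eq_of_expansion {τ r : ℂ} (hτ : 0 < τ.im) (hr : r ≠ 0) {k : ℕ} {n : Fin (k + 1)}
    {α β γ δ : ℂ} (h : IsGeneric τ r k γ δ) {c : Fin (k + 1) → ℂ}
    (hc : ∀ z, naturalVec τ r k n α β z = ∑ l, c l * naturalVec τ r k l γ δ z)
    (m : Fin (k + 1)) : R τ r k n m α β γ δ = c m := by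
  have hli := Fintype.linearIndependent_iff.mp (linearIndependent_naturalVec hτ hr h)
    (fun m => R τ r k n m α β γ δ - c m) ?_ m
  · exact sub_eq_zero.mp hli
  · funext z
    simp only [Finset.sum_apply, Pi.smul_apply, smul_eq_mul, Pi.zero_apply, sub_mul,
      Finset.sum_sub_distrib]
    rw [← hc z, ← R_spec ⟨c, hc⟩ z, sub_self]

/-! ### Paths and fusion -/

lemma onesBefore_cons_zero {k : ℕ} (i : Fin 2) (ν : Fin k → Fin 2) :
    onesBefore (Fin.cons i ν : Fin (k + 1) → Fin 2) 0 = 0 := by simp [onesBefore]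

lemma zerosBefore_cons_zero {k : ℕ} (i : Fin 2) (ν : Fin k → Fin 2) :
    zerosBefore (Fin.cons i ν : Fin (k + 1) → Fin 2) 0 = 0 := by simp [zerosBefore]

lemma onesBefore_cons_succ {k : ℕ} (i : Fin 2) (ν : Fin k → Fin 2) (j : Fin k) :
    onesBefore (Fin.cons i ν : Fin (k + 1) → Fin 2) j.succ = i + onesBefore ν j := by
  simp [onesBefore, Finset.sum_filter, Fin.sum_univ_succ]

lemma zerosBefore_cons_succ {k : ℕ} (i : Fin 2) (ν : Fin k → Fin 2) (j : Fin k) :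
    zerosBefore (Fin.cons i ν : Fin (k + 1) → Fin 2) j.succ = (1 - i) + zerosBefore ν j := by
  simp [zerosBefore, Finset.sum_filter, Fin.sum_univ_succ]

lemma onesBefore_add_zerosBefore {k : ℕ} (ν : Fin k → Fin 2) (j : Fin k) :
    onesBefore ν j + zerosBefore ν j = j := by
  have h : ∀ i : Fin k, (ν i : ℕ) + (1 - (ν i : ℕ)) = 1 := fun i => by omega
  rw [onesBefore, zerosBefore, ← Finset.sum_add_distrib]
  simp only [h, Finset.sum_const, smul_eq_mul, mul_one]
  exact (congrArg Finset.card (by ext; simp)).trans (Fin.card_Iio j)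

lemma sum_path_le {k : ℕ} (ν : Fin k → Fin 2) : ∑ j, (ν j : ℕ) ≤ k := by
  calc ∑ j, (ν j : ℕ) ≤ ∑ _j : Fin k, 1 := Finset.sum_le_sum fun j _ => by omega
    _ = k := by simp

/-- Splitting off the first factor of a vector along a path. -/
lemma shiftedFactorialPM_mul_step (τ r α β z : ℂ) (i : Fin 2) {n k : ℕ} (hn : n ≤ k) :
    shiftedFactorialPM τ r α z (i + n) * shiftedFactorialPM τ r β z (k + 1 - (i + n))
      = naturalVec τ r 1 i α β z * (shiftedFactorialPM τ r (α + (i : ℕ)) z n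
        * shiftedFactorialPM τ r (β + (1 - (i : ℕ) : ℕ)) z (k - n)) := by
  fin_cases i
  · have : k + 1 - (0 + n) = k - n + 1 := by omega
    simp only [Fin.zero_eta, naturalVec_one_zero]
    rw [this, shiftedFactorialPM_succ τ r β z (k - n)]
    simp only [zero_add, Nat.cast_zero, add_zero, Nat.sub_zero, Nat.cast_one]
    ring
  · have : k + 1 - (1 + n) = k - n := by omega
    simp only [Fin.mk_one, naturalVec_one_one]
    rw [this, add_comm 1 n, shiftedFactorialPM_succ τ r α z n]
    simp only [Nat.sub_self, Nat.cast_zero, add_zero, Nat.cast_one]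
    ring

lemma sum_eq_sum_cons {k : ℕ} (f : (Fin (k + 1) → Fin 2) → ℂ) :
    ∑ μ, f μ = ∑ m : Fin 2, ∑ μ : Fin k → Fin 2, f (Fin.cons m μ) := by
  rw [← (Fin.consEquiv fun _ => Fin 2).sum_comp, Fintype.sum_prod_type]
  rfl

/-- The expansion of a vector as a sum over all paths. -/
lemma fusion_expansion {τ r : ℂ} (hτ : 0 < τ.im) {k : ℕ} {α β γ δ : ℂ}
    (h : IsGeneric τ r k γ δ) (ν : Fin k → Fin 2) (z : ℂ) :
    shiftedFactorialPM τ r α z (∑ j, (ν j : ℕ)) * shiftedFactorialPM τ r β z (k - ∑ j, (ν j : ℕ))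
      = ∑ μ : Fin k → Fin 2, (∏ j : Fin k, R τ r 1 (ν j) (μ j)
          (α + onesBefore ν j) (β + zerosBefore ν j) (γ + onesBefore μ j) (δ + zerosBefore μ j))
        * (shiftedFactorialPM τ r γ z (∑ j, (μ j : ℕ))
          * shiftedFactorialPM τ r δ z (k - ∑ j, (μ j : ℕ))) := by
  induction k generalizing α β γ δ with
  | zero => simp [shiftedFactorialPM_zero]
  | succ k ih =>
    obtain ⟨i, ν, rfl⟩ : ∃ i ν', ν = Fin.cons i ν' := ⟨ν 0, Fin.tail ν, (Fin.cons_self_tail ν).symm⟩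
    have hone : IsGeneric τ r 1 γ δ := by
      simpa using h.shift (l := 1) (a := 0) (b := 0) (by omega)
    rw [sum_eq_sum_cons]
    simp only [Fin.sum_univ_succ (n := k), Fin.prod_univ_succ (n := k),
      Fin.cons_zero, Fin.cons_succ, onesBefore_cons_zero, zerosBefore_cons_zero,
      onesBefore_cons_succ, zerosBefore_cons_succ, Nat.cast_zero, add_zero]
    rw [shiftedFactorialPM_mul_step _ _ _ _ _ _ (sum_path_le ν), naturalVec_one_eq_sum hτ hone,
      Finset.sum_mul]
    refine Finset.sum_congr rfl fun m _ => ?_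
    have hm : IsGeneric τ r k (γ + (m : ℕ)) (δ + (1 - (m : ℕ) : ℕ)) := h.shift (by omega)
    rw [ih hm ν, Finset.mul_sum]
    refine Finset.sum_congr rfl fun μ _ => ?_
    rw [shiftedFactorialPM_mul_step _ _ _ _ _ _ (sum_path_le μ)]
    simp only [Nat.cast_add, add_assoc]
    ring

lemma naturalVec_eq_sum_paths {τ r : ℂ} (hτ : 0 < τ.im) {k : ℕ} {α β γ δ : ℂ}
    (h : IsGeneric τ r k γ δ) {n : Fin (k + 1)} {ν : Fin k → Fin 2} (hν : ∑ j, (ν j : ℕ) = n)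
    (z : ℂ) :
    naturalVec τ r k n α β z = ∑ m : Fin (k + 1), (∑ μ ∈ pathsWithSum k m, ∏ j : Fin k,
        R τ r 1 (ν j) (μ j) (α + onesBefore ν j) (β + zerosBefore ν j)
          (γ + onesBefore μ j) (δ + zerosBefore μ j)) * naturalVec τ r k m γ δ z := by
  rw [naturalVec, ← hν, fusion_expansion hτ h ν z, ← Finset.sum_fiberwise Finset.univ
    fun μ : Fin k → Fin 2 => (⟨∑ j, (μ j : ℕ), Nat.lt_succ_of_le (sum_path_le μ)⟩ : Fin (k + 1))]
  refine Finset.sum_congr rfl fun m _ => ?_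
  rw [Finset.sum_mul]
  refine Finset.sum_congr (by ext μ; simp [pathsWithSum, Fin.ext_iff]) fun μ hμ => ?_
  have : ∑ j, (μ j : ℕ) = m := by simpa [pathsWithSum] using hμ
  rw [this]
  rfl

/-- The fusion formula for the elliptic `6j`-symbols. -/
theorem R_eq_sum_paths {τ r : ℂ} (hτ : 0 < τ.im) (hr : r ≠ 0) {k : ℕ} {γ δ : ℂ}
    (h : IsGeneric τ r k γ δ) (α β : ℂ) (n m : Fin (k + 1)) (ν : Fin k → Fin 2)
    (hν : ∑ j, (ν j : ℕ) = n) :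
    R τ r k n m α β γ δ = ∑ μ ∈ pathsWithSum k m, ∏ j : Fin k,
        R τ r 1 (ν j) (μ j) (α + onesBefore ν j) (β + zerosBefore ν j)
          (γ + onesBefore μ j) (δ + zerosBefore μ j) :=
  R_eq_of_expansion hτ hr h (naturalVec_eq_sum_paths hτ h hν) m

/-! ### Existence of paths, and heights -/

lemma exists_path_with_sum {k : ℕ} (n : Fin (k + 1)) :
    ∃ ν : Fin k → Fin 2, ∑ j, (ν j : ℕ) = n := by
  refine ⟨fun j => if (j : ℕ) < n then 1 else 0, ?_⟩
  have h : ∀ j : Fin k, ((if (j : ℕ) < n then 1 else 0 : Fin 2) : ℕ)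
      = if (j : ℕ) < n then 1 else 0 := fun j => by split_ifs <;> rfl
  simp only [h]
  rw [Fin.sum_univ_eq_sum_range (fun j => if j < (n : ℕ) then 1 else 0), ← Finset.sum_filter]
  have : Finset.filter (fun j => j < (n : ℕ)) (Finset.range k) = Finset.range n := by
    ext j
    simp only [Finset.mem_filter, Finset.mem_range]
    omega
  simp [this]

/-- Heights in terms of the numbers of ones and zeros. -/
lemma height_eq {k : ℕ} (a : ℂ) (ν : Fin k → Fin 2) (j : Fin k) :
    height a ν j = a + onesBefore ν j - zerosBefore ν j := by
  have h : ∀ l : Fin k, (1 - 2 * ((ν l : ℕ) : ℂ)) = ((1 - (ν l : ℕ) : ℕ) : ℂ) - ((ν l : ℕ) : ℂ) := by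
    intro l
    rw [Nat.cast_sub (by omega)]
    push_cast
    ring
  rw [height, onesBefore, zerosBefore]
  simp only [h, Finset.sum_sub_distrib, Nat.cast_sum, Fin.lt_def]
  ring

lemma cast_index_eq {k : ℕ} (ν : Fin k → Fin 2) (j : Fin k) :
    ((j : ℕ) : ℂ) = onesBefore ν j + zerosBefore ν j := by
  exact_mod_cast (onesBefore_add_zerosBefore ν j).symm

/-- The height records ones minus zeros and the index `j` records ones plus zeros, so half their sum
recovers the number of ones. -/
lemma shift_eq_height_pos {k : ℕ} (u a : ℂ) (ν : Fin k → Fin 2) (j : Fin k) :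
    (-u + a - k + 1) / 2 + onesBefore ν j = (-u + height a ν j - k + ((j : ℕ) + 1)) / 2 := by
  rw [height_eq, cast_index_eq ν j]
  ring

lemma shift_eq_height_neg {k : ℕ} (u a : ℂ) (ν : Fin k → Fin 2) (j : Fin k) :
    (-u - a - k + 1) / 2 + zerosBefore ν j = (-u - height a ν j - k + ((j : ℕ) + 1)) / 2 := by
  rw [height_eq, cast_index_eq ν j]
  ring

end Elliptic6j

theorem mainTheorem7 (τ r : ℂ) (hτ : 0 < τ.im) (hr : r ≠ 0) (k : ℕ) :
    -- for generic parameters, the symbols are well defined at level `k` (in particular at level 1)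
    (∀ α β γ δ : ℂ, Elliptic6j.IsGeneric τ r k γ δ →
      LinearIndependent ℂ
          (fun m : Fin (k + 1) => Elliptic6j.naturalVec τ r k m γ δ) ∧
        ∀ (n : Fin (k + 1)) (z : ℂ),
          Elliptic6j.naturalVec τ r k n α β z
            = ∑ m : Fin (k + 1), Elliptic6j.R τ r k n m α β γ δ
                * Elliptic6j.naturalVec τ r k m γ δ z) ∧
    -- the parameters of all the factors of the fusion formula are generic at level 1
    (∀ γ δ : ℂ, Elliptic6j.IsGeneric τ r k γ δ → ∀ (μ : Fin k → Fin 2) (j : Fin k),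
      Elliptic6j.IsGeneric τ r 1
        (γ + Elliptic6j.onesBefore μ j) (δ + Elliptic6j.zerosBefore μ j)) ∧
    -- the fusion formula
    (∀ α β γ δ : ℂ, Elliptic6j.IsGeneric τ r k γ δ →
      ∀ (n m : Fin (k + 1)) (ν : Fin k → Fin 2), ∑ j, (ν j : ℕ) = n →
        Elliptic6j.R τ r k n m α β γ δ
          = ∑ μ ∈ Elliptic6j.pathsWithSum k m, ∏ j : Fin k,
              Elliptic6j.R τ r 1 (ν j) (μ j)
                (α + Elliptic6j.onesBefore ν j) (β + Elliptic6j.zerosBefore ν j)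
                (γ + Elliptic6j.onesBefore μ j) (δ + Elliptic6j.zerosBefore μ j)) ∧
    -- the same formula along height paths (here `j` runs over `0, …, k - 1`)
    (∀ u a c : ℂ,
      Elliptic6j.IsGeneric τ r k ((-u + c - k + 1) / 2) ((-u - c - k + 1) / 2) →
      ∀ (n m : Fin (k + 1)) (ν : Fin k → Fin 2), ∑ j, (ν j : ℕ) = n →
        Elliptic6j.R τ r k n m
            ((-u + a - k + 1) / 2) ((-u - a - k + 1) / 2)
            ((-u + c - k + 1) / 2) ((-u - c - k + 1) / 2)
          = ∑ μ ∈ Elliptic6j.pathsWithSum k m, ∏ j : Fin k,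
              Elliptic6j.R τ r 1 (ν j) (μ j)
                ((-u + Elliptic6j.height a ν j - k + ((j : ℕ) + 1)) / 2)
                ((-u - Elliptic6j.height a ν j - k + ((j : ℕ) + 1)) / 2)
                ((-u + Elliptic6j.height c μ j - k + ((j : ℕ) + 1)) / 2)
                ((-u - Elliptic6j.height c μ j - k + ((j : ℕ) + 1)) / 2)) := by
  refine ⟨fun α β γ δ h => ⟨Elliptic6j.linearIndependent_naturalVec hτ hr h, fun n z => ?_⟩,
    fun γ δ h μ j => h.shift ?_,
    fun α β γ δ h n m ν hν => Elliptic6j.R_eq_sum_paths hτ hr h α β n m ν hν,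
    fun u a c h n m ν hν => ?_⟩
  -- Any single path of sum `n` yields an expansion, so `R` is not the default value `0` by lack of
  -- one.
  · obtain ⟨ν, hν⟩ := Elliptic6j.exists_path_with_sum n
    exact Elliptic6j.R_spec ⟨_, Elliptic6j.naturalVec_eq_sum_paths hτ h hν⟩ z
  · have := Elliptic6j.onesBefore_add_zerosBefore μ j
    omega
  · simp only [← Elliptic6j.shift_eq_height_pos, ← Elliptic6j.shift_eq_height_neg]
    exact Elliptic6j.R_eq_sum_paths hτ hr h _ _ n m ν hν
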